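/- Let $q$ be a prime power and $n \geq 2$. Let $G = GL(n,q)$ be the group of invertible $n \times n$ matrices over the finite field with $q$ elements, and let $H = GL(n-1,q)$, embedded in $G$ as the subgroup of block diagonal matrices $\mathrm{diag}(A,1)$ with $A$ an invertible $(n-1)\times(n-1)$ matrix. Put $$\beta = \max_{g \in G,\ g \neq 1} \frac{|g^G \cap H|}{|g^G|},$$ where $g^G$ denotes the conjugacy class of $g$ in $G$. Then $$\beta = \frac{1 - 1/q^{n-1}}{q^2\,(1 - 1/q^n)} \quad \text{if } q > 2, \qquad \beta = \frac{1 - 1/q^{n-2}}{q^2\,(1 - 1/q^n)} \quad \text{if } q = 2.$$ -/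

import Mathlib

open scoped MatrixGroups

/-- For a subgroup `H` of a finite group `G` and `g : G`, the proportion
`|g^G ∩ H| / |g^G|` of the conjugacy class `g^G` of `g` in `G` that lies in `H`. -/
noncomputable def classProportion {G : Type*} [Group G] (H : Subgroup G) (g : G) : ℝ :=
  ((conjugatesOf g ∩ (H : Set G)).ncard : ℝ) / ((conjugatesOf g).ncard : ℝ)

/-- The monoid homomorphism from `m × m` matrices to `n × n` matrices, `n = m + 1`, sending `A`
to the block diagonal matrix `diag(A, 1)`. -/
def matrixCornerHom (R : Type*) [CommRing R] {m n : ℕ} (h : m + 1 = n) :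
    Matrix (Fin m) (Fin m) R →* Matrix (Fin n) (Fin n) R where
  toFun A := Matrix.reindex (finSumFinEquiv.trans (finCongr h)) (finSumFinEquiv.trans (finCongr h))
    (Matrix.fromBlocks A 0 0 (1 : Matrix (Fin 1) (Fin 1) R))
  map_one' := by
    rw [Matrix.fromBlocks_one, Matrix.reindex_apply, Matrix.submatrix_one_equiv]
  map_mul' A B := by
    simp only [Matrix.reindex_apply, Matrix.submatrix_mul_equiv, Matrix.fromBlocks_multiply]
    simp

/-- The standard embedding `GL(m, R) → GL(n, R)`, `A ↦ diag(A, 1)`, where `n = m + 1`. -/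
def glCornerHom (R : Type*) [CommRing R] {m n : ℕ} (h : m + 1 = n) :
    GL (Fin m) R →* GL (Fin n) R :=
  Units.map (matrixCornerHom R h)

/-- `GL(n - 1, R)` as a subgroup of `GL(n, R)` (for `n ≥ 1`): the matrices `diag(A, 1)` with
`A` in `GL(n - 1, R)`. -/
def glCorner (R : Type*) [CommRing R] (n : ℕ) (hn : 1 ≤ n) : Subgroup (GL (Fin n) R) :=
  (glCornerHom R (Nat.sub_add_cancel hn)).range

/-! ### Conjugacy class proportions as fixed-point ratios -/

section Counting

/-! `H` is the stabilizer of a pair (v, φ) with φ(v) = 1, and `G` is transitive on such pairs, so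
the proportion for `g` is the fraction of pairs fixed by `g` (`classProportion_stabilizer`). The
fixed vectors and fixed covectors of `g` have a common dimension d < n. A fixed v killed by every
fixed covector lies in no fixed pair, and any other lies in q^(d-1) of them. With r the number of
the former, the proportion is q^d (q^d - r) / (q^n (q^n - 1)) (`classProportion_glCorner`).

It remains to take d large and r small. For q > 2 a reflection gives d = n - 1 and r = 1. For q = 2
and d = n - 1, the line im(g - 1) is itself fixed and killed by all fixed covectors, so r ≥ 2, with
equality for a transvection; smaller d gives less. -/

theorem mem_conjugatesOf {G : Type*} [Monoid G] {g y : G} : y ∈ conjugatesOf g ↔ IsConj g y :=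
  Iff.rfl

/-- For a transitive action, the proportion of a conjugacy class lying in a point stabilizer is the
proportion of points fixed by an element of the class. -/
theorem classProportion_stabilizer {G X : Type*} [Group G] [Finite G] [MulAction G X] [Finite X]
    [MulAction.IsPretransitive G X] (x : X) (g : G) :
    classProportion (MulAction.stabilizer G x) g =
      (Nat.card (MulAction.fixedBy X g) : ℝ) / (Nat.card X : ℝ) := by
  classical
  have := Fintype.ofFinite G
  have := Fintype.ofFinite X
  -- Double count the pairs (y, z) with y conjugate to g and y • z = z; conjugation makes both fibre
  -- sizes constant.
  have key := Finset.card_mul_eq_card_mul (fun (y : G) (z : X) => y • z = z)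
    (s := (conjugatesOf g).toFinset) (t := (Finset.univ : Finset X))
    (m := Nat.card (MulAction.fixedBy X g))
    (n := (conjugatesOf g ∩ (MulAction.stabilizer G x : Set G)).ncard) ?_ ?_
  · rw [← Set.ncard_eq_toFinset_card', Finset.card_univ, ← Nat.card_eq_fintype_card] at key
    have hX : (Nat.card X : ℝ) ≠ 0 := by
      have : Nonempty X := ⟨x⟩
      exact_mod_cast Nat.card_pos.ne'
    have hC : ((conjugatesOf g).ncard : ℝ) ≠ 0 := by
      have := (Set.ncard_pos (Set.toFinite _)).2 ⟨g, mem_conjugatesOf_self⟩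
      exact_mod_cast this.ne'
    rw [classProportion, div_eq_div_iff hC hX]
    have key' : ((conjugatesOf g).ncard : ℝ) * Nat.card (MulAction.fixedBy X g) =
      Nat.card X * (conjugatesOf g ∩ (MulAction.stabilizer G x : Set G)).ncard := by
      exact_mod_cast key
    linarith
  · intro a ha
    rw [Set.mem_toFinset, mem_conjugatesOf, isConj_iff] at ha
    obtain ⟨c, rfl⟩ := ha
    rw [Nat.card_coe_set_eq, Set.ncard_eq_toFinset_card']
    refine Finset.card_bij' (fun z _ => c⁻¹ • z) (fun z _ => c • z) ?_ ?_ ?_ ?_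
    · intro z hz
      simp only [Finset.bipartiteAbove, Finset.mem_filter, Finset.mem_univ, true_and] at hz
      simp only [Set.mem_toFinset, MulAction.mem_fixedBy]
      rw [mul_smul, mul_smul] at hz
      rw [eq_inv_smul_iff, hz]
    · intro z hz
      simp only [Set.mem_toFinset, MulAction.mem_fixedBy] at hz
      simp [Finset.bipartiteAbove, mul_smul, hz]
    · simp
    · simp
  · intro z _
    obtain ⟨c, rfl⟩ := MulAction.exists_smul_eq G x z
    rw [Set.ncard_eq_toFinset_card']
    have hc (y d : G) (h : IsConj g y) : IsConj g (d * y * d⁻¹) :=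
      h.trans (isConj_iff.2 ⟨d, rfl⟩)
    refine Finset.card_bij' (fun y _ => c⁻¹ * y * c) (fun y _ => c * y * c⁻¹) ?_ ?_ ?_ ?_
    · intro y hy
      simp only [Finset.bipartiteBelow, Finset.mem_filter, Set.mem_toFinset,
        mem_conjugatesOf] at hy
      simp only [Set.mem_toFinset, Set.mem_inter_iff, mem_conjugatesOf, SetLike.mem_coe,
        MulAction.mem_stabilizer_iff]
      refine ⟨by simpa only [inv_inv] using hc y c⁻¹ hy.1, ?_⟩
      rw [mul_smul, mul_smul, hy.2, inv_smul_smul]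
    · intro y hy
      simp only [Set.mem_toFinset, Set.mem_inter_iff, mem_conjugatesOf, SetLike.mem_coe,
        MulAction.mem_stabilizer_iff] at hy
      simp only [Finset.bipartiteBelow, Finset.mem_filter, Set.mem_toFinset,
        mem_conjugatesOf]
      refine ⟨hc y c hy.1, ?_⟩
      rw [mul_smul, mul_smul, inv_smul_smul, hy.2]
    · intro y _; group
    · intro y _; group

end Counting

/-! ### The transitive action on dual pairs -/

section DualPairs

variable {F : Type*} [Field F] {n : ℕ}

/-- Pairs consisting of a vector and a covector taking the value `1` on it. -/
def DualPair (F : Type*) [Field F] (n : ℕ) : Type _ :=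
  {p : (Fin n → F) × (Fin n → F) // p.2 ⬝ᵥ p.1 = 1}

instance [Finite F] : Finite (DualPair F n) :=
  inferInstanceAs (Finite {p : (Fin n → F) × (Fin n → F) // p.2 ⬝ᵥ p.1 = 1})

open Matrix in
instance : MulAction (GL (Fin n) F) (DualPair F n) where
  smul g p := ⟨((g : Matrix (Fin n) (Fin n) F) *ᵥ p.1.1,
    p.1.2 ᵥ* ((g⁻¹ : GL (Fin n) F) : Matrix (Fin n) (Fin n) F)), by
      rw [← Matrix.dotProduct_mulVec, Matrix.mulVec_mulVec, ← Units.val_mul, inv_mul_cancel,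
        Units.val_one, Matrix.one_mulVec]
      exact p.2⟩
  one_smul p := by
    refine Subtype.ext (Prod.ext ?_ ?_)
    · change ((1 : GL (Fin n) F) : Matrix (Fin n) (Fin n) F) *ᵥ p.1.1 = _
      rw [Units.val_one, Matrix.one_mulVec]
    · change p.1.2 ᵥ* (((1 : GL (Fin n) F)⁻¹ : GL (Fin n) F) : Matrix (Fin n) (Fin n) F) = _
      rw [inv_one, Units.val_one, Matrix.vecMul_one]
  mul_smul g h p := by
    refine Subtype.ext (Prod.ext ?_ ?_)
    · change ((g * h : GL (Fin n) F) : Matrix (Fin n) (Fin n) F) *ᵥ p.1.1 =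
        (g : Matrix (Fin n) (Fin n) F) *ᵥ ((h : Matrix (Fin n) (Fin n) F) *ᵥ p.1.1)
      rw [Units.val_mul, Matrix.mulVec_mulVec]
    · change p.1.2 ᵥ* (((g * h)⁻¹ : GL (Fin n) F) : Matrix (Fin n) (Fin n) F) =
        (p.1.2 ᵥ* ((h⁻¹ : GL (Fin n) F) : Matrix (Fin n) (Fin n) F)) ᵥ*
          ((g⁻¹ : GL (Fin n) F) : Matrix (Fin n) (Fin n) F)
      rw [_root_.mul_inv_rev, Units.val_mul, Matrix.vecMul_vecMul]

open Matrix in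
theorem DualPair.smul_eq_iff (g : GL (Fin n) F) (p p' : DualPair F n) :
    g • p = p' ↔ (g : Matrix (Fin n) (Fin n) F) *ᵥ p.1.1 = p'.1.1 ∧
      p'.1.2 ᵥ* (g : Matrix (Fin n) (Fin n) F) = p.1.2 := by
  have h : g • p = p' ↔ (g : Matrix (Fin n) (Fin n) F) *ᵥ p.1.1 = p'.1.1 ∧
      p.1.2 ᵥ* ((g⁻¹ : GL (Fin n) F) : Matrix (Fin n) (Fin n) F) = p'.1.2 :=
    Subtype.ext_iff.trans Prod.ext_iff
  rw [h]
  refine and_congr_right fun _ => ⟨fun h => ?_, fun h => ?_⟩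
  · rw [← h, Matrix.vecMul_vecMul, ← Units.val_mul, inv_mul_cancel, Units.val_one,
      Matrix.vecMul_one]
  · rw [← h, Matrix.vecMul_vecMul, ← Units.val_mul, mul_inv_cancel, Units.val_one,
      Matrix.vecMul_one]

open Matrix in
/-- A rank one perturbation of the identity with nonzero determinant, as an invertible matrix. -/
theorem exists_gl_one_add_vecMulVec (a b : Fin n → F) (h : 1 + b ⬝ᵥ a ≠ 0) :
    ∃ g : GL (Fin n) F, (g : Matrix (Fin n) (Fin n) F) = 1 + vecMulVec a b := by
  refine ⟨Matrix.GeneralLinearGroup.mkOfDetNeZero (1 + vecMulVec a b) ?_, rfl⟩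
  rwa [vecMulVec_eq Unit, det_one_add_replicateCol_mul_replicateRow]

open Matrix in
-- A sum of the two covectors works when neither covector alone does.
theorem DualPair.exists_covector_ne_zero (p p' : DualPair F n) :
    ∃ ψ : Fin n → F, ψ ⬝ᵥ p.1.1 ≠ 0 ∧ ψ ⬝ᵥ p'.1.1 ≠ 0 := by
  have h := p.2
  have h' := p'.2
  by_cases h1 : p.1.2 ⬝ᵥ p'.1.1 = 0
  · by_cases h2 : p'.1.2 ⬝ᵥ p.1.1 = 0
    · exact ⟨p.1.2 + p'.1.2, by simp [add_dotProduct, *], by simp [add_dotProduct, *]⟩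
    · exact ⟨p'.1.2, h2, by simp [h']⟩
  · exact ⟨p.1.2, by simp [h], h1⟩

open Matrix in
instance : MulAction.IsPretransitive (GL (Fin n) F) (DualPair F n) := by
  refine ⟨fun p p' => ?_⟩
  obtain ⟨ψ, h1, h2⟩ := p.exists_covector_ne_zero p'
  -- g carries the first vector to the second; its determinant is ψ(v')/ψ(v).
  obtain ⟨g, hg⟩ := exists_gl_one_add_vecMulVec (p'.1.1 - p.1.1) ((ψ ⬝ᵥ p.1.1)⁻¹ • ψ) (by
    rw [smul_dotProduct, dotProduct_sub, smul_eq_mul, mul_sub, inv_mul_cancel₀ h1,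
      add_sub_cancel]
    exact mul_ne_zero (inv_ne_zero h1) h2)
  have hgv : (g • p).1.1 = p'.1.1 := by
    change (g : Matrix (Fin n) (Fin n) F) *ᵥ p.1.1 = _
    rw [hg, add_mulVec, one_mulVec, vecMulVec_mulVec, smul_dotProduct, smul_eq_mul,
      inv_mul_cancel₀ h1]
    simp
  have h3 : (g • p).1.2 ⬝ᵥ p'.1.1 = 1 := by rw [← hgv]; exact (g • p).2
  have h0 : ((g • p).1.2 - p'.1.2) ⬝ᵥ p'.1.1 = 0 := by
    rw [sub_dotProduct, h3, p'.2, sub_self]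
  -- k fixes the vector already in place and corrects the covector.
  obtain ⟨k, hk⟩ := exists_gl_one_add_vecMulVec p'.1.1 ((g • p).1.2 - p'.1.2) (by simp [h0])
  refine ⟨k * g, ?_⟩
  rw [mul_smul, DualPair.smul_eq_iff, hk, hgv]
  constructor
  · rw [add_mulVec, one_mulVec, vecMulVec_mulVec, h0]
    simp
  · rw [vecMul_add, vecMul_one, vecMul_vecMulVec, p'.2]
    simp

/-- The dual pair of the last basis vector and the last coordinate function. -/
def DualPair.last (F : Type*) [Field F] (n : ℕ) (hn : 1 ≤ n) : DualPair F n :=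
  ⟨(Pi.single ⟨n - 1, by omega⟩ 1, Pi.single ⟨n - 1, by omega⟩ 1), by simp⟩

open Matrix in
theorem glCorner_eq_stabilizer (hn : 1 ≤ n) :
    glCorner F n hn = MulAction.stabilizer (GL (Fin n) F) (DualPair.last F n hn) := by
  obtain ⟨m, rfl⟩ : ∃ m, n = m + 1 := ⟨n - 1, by omega⟩
  let e : Fin m ⊕ Fin 1 ≃ Fin (m + 1) :=
    finSumFinEquiv.trans (finCongr (Nat.sub_add_cancel hn))
  have hlast : (⟨m + 1 - 1, by omega⟩ : Fin (m + 1)) = e (Sum.inr 0) := Fin.ext (by simp [e])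
  have hp1 : (DualPair.last F (m + 1) hn).1.1 = Pi.single (e (Sum.inr 0)) 1 := by
    rw [← hlast]; rfl
  have hp2 : (DualPair.last F (m + 1) hn).1.2 = Pi.single (e (Sum.inr 0)) 1 := by
    rw [← hlast]; rfl
  ext g
  rw [MulAction.mem_stabilizer_iff, DualPair.smul_eq_iff, hp1, hp2, mulVec_single_one,
    single_one_vecMul]
  have hcorner (A : Matrix (Fin m) (Fin m) F) (s t) :
      matrixCornerHom F (Nat.sub_add_cancel hn) A (e s) (e t) =
        fromBlocks A 0 0 (1 : Matrix (Fin 1) (Fin 1) F) s t := by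
    change fromBlocks A 0 0 (1 : Matrix (Fin 1) (Fin 1) F) (e.symm (e s)) (e.symm (e t)) = _
    simp
  constructor
  · rintro ⟨A, rfl⟩
    constructor
    · funext i
      obtain ⟨s, rfl⟩ := e.surjective i
      refine (hcorner A.1 s (Sum.inr 0)).trans ?_
      rcases s with s | s
      · simp
      · simp [Subsingleton.elim s 0]
    · funext i
      obtain ⟨s, rfl⟩ := e.surjective i
      refine (hcorner A.1 (Sum.inr 0) s).trans ?_
      rcases s with s | s
      · simp
      · simp [Subsingleton.elim s 0]
  · rintro ⟨hcol, hrow⟩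
    let A : Matrix (Fin m) (Fin m) F := fun i j => g (e (Sum.inl i)) (e (Sum.inl j))
    have hA : matrixCornerHom F (Nat.sub_add_cancel hn) A = g := by
      ext i j
      obtain ⟨s, rfl⟩ := e.surjective i
      obtain ⟨t, rfl⟩ := e.surjective j
      rw [hcorner]
      have hc := congr_fun hcol (e s)
      have hr := congr_fun hrow (e t)
      rcases s with s | s <;> rcases t with t | t
      · rfl
      · rw [Subsingleton.elim t 0]
        simpa using hc.symm
      · rw [Subsingleton.elim s 0]
        simpa using hr.symm
      · rw [Subsingleton.elim s 0, Subsingleton.elim t 0]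
        rw [Subsingleton.elim s 0] at hc
        simpa using hc.symm
    have hdet : A.det ≠ 0 := by
      have h : (matrixCornerHom F (Nat.sub_add_cancel hn) A).det = A.det := by
        rw [← det_submatrix_equiv_self e]
        have : (matrixCornerHom F (Nat.sub_add_cancel hn) A).submatrix e e =
            fromBlocks A 0 0 (1 : Matrix (Fin 1) (Fin 1) F) := by
          ext s t
          exact hcorner A s t
        rw [this, det_fromBlocks_zero₂₁, det_one, mul_one]
      rw [← h, hA]
      exact ((isUnit_iff_isUnit_det _).1 g.isUnit).ne_zero
    exact ⟨GeneralLinearGroup.mkOfDetNeZero A hdet, Units.ext hA⟩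

end DualPairs

/-! ### Counting fixed pairs -/

section FixedPairs

variable {F : Type*} [Field F] {n : ℕ}

/-- The level set at `1` of a nonzero linear form has index `|F|` in the whole space. -/
theorem card_eq_one_mul_card {V : Type*} [AddCommGroup V] [Module F V]
    (f : V →ₗ[F] F) (hf : f ≠ 0) :
    Nat.card {x // f x = 1} * Nat.card F = Nat.card V := by
  obtain ⟨x₀, hx₀⟩ := LinearMap.surjective hf 1
  rw [← Nat.card_prod]
  refine Nat.card_congr
    { toFun := fun p => p.1.1 + (p.2 - 1) • x₀
      invFun := fun y => (⟨y - (f y - 1) • x₀, by simp [hx₀]⟩, f y)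
      left_inv := ?_
      right_inv := fun y => by simp }
  rintro ⟨⟨x, hx⟩, c⟩
  simp [hx, hx₀]

/-- The vectors of `U` on which every covector of `L` vanishes. -/
def pairingRadical (U L : Submodule F (Fin n → F)) : Set U :=
  {v | ∀ φ ∈ L, φ ⬝ᵥ v.1 = 0}

/-- Sum over v in `U`: evaluation at v is a linear form on `L`, taking the value 1 on |L|/|F|
covectors, or on none if v is in the radical. -/
theorem card_dualPair_mem [Finite F] (U L : Submodule F (Fin n → F)) :
    Nat.card {p : DualPair F n // p.1.1 ∈ U ∧ p.1.2 ∈ L} * Nat.card F +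
      Nat.card L * (pairingRadical U L).ncard = Nat.card L * Nat.card U := by
  classical
  have := Fintype.ofFinite F
  have := Fintype.ofFinite U
  let ev (v : U) : L →ₗ[F] F :=
    { toFun := fun φ => φ.1 ⬝ᵥ v.1
      map_add' := fun a b => add_dotProduct _ _ _
      map_smul' := fun c a => smul_dotProduct _ _ _ }
  have hev (v : U) : ev v = 0 ↔ v ∈ pairingRadical U L :=
    ⟨fun h φ hφ => LinearMap.congr_fun h ⟨φ, hφ⟩, fun h => LinearMap.ext fun φ => h φ.1 φ.2⟩
  have e : {p : DualPair F n // p.1.1 ∈ U ∧ p.1.2 ∈ L} ≃ (Σ v : U, {φ : L // ev v φ = 1}) :=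
    { toFun := fun p => ⟨⟨p.1.1.1, p.2.1⟩, ⟨⟨p.1.1.2, p.2.2⟩, p.1.2⟩⟩
      invFun := fun s => ⟨⟨(s.1.1, s.2.1.1), s.2.2⟩, s.1.2, s.2.1.2⟩
      left_inv := fun _ => rfl
      right_inv := fun _ => rfl }
  rw [Nat.card_congr e, Nat.card_sigma, Finset.sum_mul, Set.ncard_eq_toFinset_card',
    ← Set.filter_mem_univ_eq_toFinset, Finset.card_filter, Finset.mul_sum,
    ← Finset.sum_add_distrib, Finset.sum_congr rfl (g := fun _ => Nat.card L), Finset.sum_const,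
    Finset.card_univ, ← Nat.card_eq_fintype_card, smul_eq_mul, mul_comm]
  intro v _
  by_cases hv : v ∈ pairingRadical U L
  · have h0 := (hev v).2 hv
    have : IsEmpty {φ : L // ev v φ = 1} := ⟨fun φ => by simpa [h0] using φ.2⟩
    simp [hv]
  · rw [card_eq_one_mul_card (ev v) (fun h => hv ((hev v).1 h))]
    simp [hv]

open Matrix

/-- The vectors fixed by `g`. -/
def fixedVec (g : GL (Fin n) F) : Submodule F (Fin n → F) :=
  LinearMap.ker (mulVecLin ((g : Matrix (Fin n) (Fin n) F) - 1))

/-- The covectors fixed by `g`. -/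
def fixedCovec (g : GL (Fin n) F) : Submodule F (Fin n → F) :=
  LinearMap.ker (mulVecLin ((g : Matrix (Fin n) (Fin n) F) - 1)ᵀ)

theorem mem_fixedVec (g : GL (Fin n) F) (v : Fin n → F) :
    v ∈ fixedVec g ↔ (g : Matrix (Fin n) (Fin n) F) *ᵥ v = v := by
  simp [fixedVec, sub_eq_zero]

theorem mem_fixedCovec (g : GL (Fin n) F) (φ : Fin n → F) :
    φ ∈ fixedCovec g ↔ φ ᵥ* (g : Matrix (Fin n) (Fin n) F) = φ := by
  rw [fixedCovec, LinearMap.mem_ker, mulVecLin_apply, mulVec_transpose, vecMul_sub, vecMul_one,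
    sub_eq_zero]

theorem finrank_fixedVec_add_rank (g : GL (Fin n) F) :
    ((g : Matrix (Fin n) (Fin n) F) - 1).rank + Module.finrank F (fixedVec g) = n := by
  have := (mulVecLin ((g : Matrix (Fin n) (Fin n) F) - 1)).finrank_range_add_finrank_ker
  rwa [Module.finrank_fin_fun] at this

theorem finrank_fixedCovec (g : GL (Fin n) F) :
    Module.finrank F (fixedCovec g) = Module.finrank F (fixedVec g) := by
  have h := (mulVecLin ((g : Matrix (Fin n) (Fin n) F) - 1)ᵀ).finrank_range_add_finrank_ker
  rw [Module.finrank_fin_fun] at h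
  change rank _ + Module.finrank F (fixedCovec g) = n at h
  rw [rank_transpose] at h
  have := finrank_fixedVec_add_rank g
  omega

theorem finrank_fixedVec_lt (g : GL (Fin n) F) (hg : g ≠ 1) :
    Module.finrank F (fixedVec g) < n := by
  have h := finrank_fixedVec_add_rank g
  have : ((g : Matrix (Fin n) (Fin n) F) - 1).rank ≠ 0 := fun h0 => by
    have hr := LinearMap.range_eq_bot.1 (Submodule.finrank_eq_zero.1 h0)
    refine hg (Units.ext (sub_eq_zero.1 (Matrix.ext_of_mulVec_single fun i => ?_)))
    rw [zero_mulVec]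
    exact LinearMap.congr_fun hr (Pi.single i 1)
  omega

/-- The proportion in terms of the dimension of the fixed space and the radical of the pairing
between fixed vectors and fixed covectors. -/
theorem classProportion_glCorner [Finite F] (hn : 1 ≤ n) (g : GL (Fin n) F) :
    classProportion (glCorner F n hn) g =
      (Nat.card F : ℝ) ^ Module.finrank F (fixedVec g) *
        ((Nat.card F : ℝ) ^ Module.finrank F (fixedVec g) -
          ((pairingRadical (fixedVec g) (fixedCovec g)).ncard : ℝ)) /
        ((Nat.card F : ℝ) ^ n * ((Nat.card F : ℝ) ^ n - 1)) := by
  have hF : (Nat.card F : ℝ) ≠ 0 := by exact_mod_cast Nat.card_pos.ne'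
  rw [glCorner_eq_stabilizer, classProportion_stabilizer]
  have e : MulAction.fixedBy (DualPair F n) g ≃
      {p : DualPair F n // p.1.1 ∈ fixedVec g ∧ p.1.2 ∈ fixedCovec g} :=
    Equiv.subtypeEquivRight fun p => by
      rw [MulAction.mem_fixedBy, DualPair.smul_eq_iff, mem_fixedVec, mem_fixedCovec]
  have h1 := card_dualPair_mem (fixedVec g) (fixedCovec g)
  -- The same count, with nondegenerate pairing, gives the number of all pairs.
  have h2 := card_dualPair_mem (⊤ : Submodule F (Fin n → F)) ⊤
  have h3 : (pairingRadical (⊤ : Submodule F (Fin n → F)) ⊤).ncard = 1 := by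
    rw [Set.ncard_eq_one]
    refine ⟨0, Set.eq_singleton_iff_unique_mem.2 ⟨fun φ _ => dotProduct_zero φ, fun v hv => ?_⟩⟩
    ext i
    simpa using hv (Pi.single i 1) trivial
  rw [← Nat.card_congr e] at h1
  rw [h3, Nat.card_congr (Equiv.subtypeUnivEquiv (fun p => ⟨trivial, trivial⟩))] at h2
  rw [Module.natCard_eq_pow_finrank (K := F) (V := fixedVec g),
    Module.natCard_eq_pow_finrank (K := F) (V := fixedCovec g), finrank_fixedCovec] at h1
  rw [Module.natCard_eq_pow_finrank (K := F) (V := (⊤ : Submodule F (Fin n → F))),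
    finrank_top, Module.finrank_fin_fun] at h2
  have h1' : (Nat.card (MulAction.fixedBy (DualPair F n) g) : ℝ) * Nat.card F =
      (Nat.card F : ℝ) ^ Module.finrank F (fixedVec g) *
        ((Nat.card F : ℝ) ^ Module.finrank F (fixedVec g) -
          ((pairingRadical (fixedVec g) (fixedCovec g)).ncard : ℝ)) := by
    rw [mul_sub, eq_sub_iff_add_eq]
    exact_mod_cast h1
  have h2' : (Nat.card (DualPair F n) : ℝ) * Nat.card F =
      (Nat.card F : ℝ) ^ n * ((Nat.card F : ℝ) ^ n - 1) := by
    rw [mul_sub, eq_sub_iff_add_eq]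
    exact_mod_cast h2
  rw [← h1', ← h2', mul_div_mul_right _ _ hF]

theorem zero_mem_pairingRadical (U L : Submodule F (Fin n → F)) : 0 ∈ pairingRadical U L :=
  fun φ _ => dotProduct_zero φ

/-- Over the field with two elements, the radical is nontrivial for elements whose fixed space is
a hyperplane. -/
theorem two_le_ncard_pairingRadical [Finite F] (hF : Nat.card F = 2) (g : GL (Fin n) F)
    (hd : Module.finrank F (fixedVec g) + 1 = n) :
    2 ≤ (pairingRadical (fixedVec g) (fixedCovec g)).ncard := by
  have hr := finrank_fixedVec_add_rank g
  set N := (g : Matrix (Fin n) (Fin n) F) - 1 with hN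
  have hr1 : Module.finrank F (LinearMap.range N.mulVecLin) = 1 := by
    change N.rank = 1
    omega
  -- The image of N is a line, so its generator N x is an eigenvector of N, with eigenvalue c.
  obtain ⟨⟨_, x, rfl⟩, ha0, ha⟩ := finrank_eq_one_iff'.1 hr1
  obtain ⟨c, hc⟩ := ha ⟨N.mulVecLin (N.mulVecLin x), _, rfl⟩
  simp only [Subtype.ext_iff, ne_eq, SetLike.mk_smul_mk, mulVecLin_apply, ZeroMemClass.coe_zero]
    at ha0 hc
  have hg : (g : Matrix (Fin n) (Fin n) F) = 1 + N := by rw [hN]; abel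
  have hga : (g : Matrix (Fin n) (Fin n) F) *ᵥ (N *ᵥ x) = (1 + c) • (N *ᵥ x) := by
    rw [hg, add_mulVec, one_mulVec, ← hc, add_smul, one_smul]
  have hc1 : 1 + c ≠ 0 := by
    intro h
    rw [h, zero_smul] at hga
    apply ha0
    have := congrArg (((g⁻¹ : GL (Fin n) F) : Matrix (Fin n) (Fin n) F) *ᵥ ·) hga
    simpa only [mulVec_mulVec, ← Units.val_mul, ← mul_assoc, inv_mul_cancel, Units.val_one,
      one_mul, mulVec_zero] using this
  have hc2 : 1 + c = 1 := by
    have := Fintype.ofFinite F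
    rw [← pow_one (1 + c)]
    have := FiniteField.pow_card_sub_one_eq_one (1 + c) hc1
    rwa [← Nat.card_eq_fintype_card, hF] at this
  have hfix : N *ᵥ x ∈ fixedVec g := by
    rw [mem_fixedVec, hga, hc2, one_smul]
  rw [Nat.succ_le_iff, Set.one_lt_ncard_iff]
  refine ⟨0, ⟨N *ᵥ x, hfix⟩, zero_mem_pairingRadical _ _, fun φ hφ => ?_, fun h => ?_⟩
  -- A fixed covector satisfies φN = 0, so it kills the image of N.
  · rw [mem_fixedCovec, hg, vecMul_add, vecMul_one, add_eq_left] at hφ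
    rw [dotProduct_mulVec, hφ, zero_dotProduct]
  · exact ha0 (Subtype.ext_iff.1 h).symm

-- Elements attaining the maximum

end FixedPairs

section Extremal

variable {F : Type*} [Field F] {n : ℕ}

open Matrix

theorem finrank_fixedVec_one_add_vecMulVec {g : GL (Fin n) F} {a b : Fin n → F}
    (hg : (g : Matrix (Fin n) (Fin n) F) = 1 + vecMulVec a b) (hg1 : g ≠ 1) :
    Module.finrank F (fixedVec g) = n - 1 := by
  have h1 := finrank_fixedVec_add_rank g
  have h2 := finrank_fixedVec_lt g hg1
  rw [hg, add_sub_cancel_left] at h1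
  have h3 := rank_vecMulVec_le a b
  omega

theorem apply_eq_zero_of_mem_pairingRadical {g : GL (Fin n) F} {i : Fin n} {b : Fin n → F}
    (hg : (g : Matrix (Fin n) (Fin n) F) = 1 + vecMulVec (Pi.single i 1) b)
    {v : fixedVec g} (hv : v ∈ pairingRadical (fixedVec g) (fixedCovec g)) {k : Fin n}
    (hk : k ≠ i) : v.1 k = 0 := by
  have h := hv (Pi.single k 1) (by
    rw [mem_fixedCovec, hg, vecMul_add, vecMul_one, vecMul_vecMulVec]
    simp [hk.symm])
  simpa using h

theorem exists_reflection [Finite F] (hF : 2 < Nat.card F) (hn : 1 ≤ n) :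
    ∃ g : GL (Fin n) F, g ≠ 1 ∧ Module.finrank F (fixedVec g) = n - 1 ∧
      (pairingRadical (fixedVec g) (fixedCovec g)).ncard = 1 := by
  classical
  have := Fintype.ofFinite F
  -- For 1 + c E_ii: c ≠ 0 makes it nontrivial, c ≠ -1 invertible.
  obtain ⟨c, hc⟩ : ∃ c : F, c ∉ ({0, -1} : Finset F) := by
    by_contra! h
    have h1 : Fintype.card F ≤ ({0, -1} : Finset F).card :=
      Finset.card_le_card (fun x _ => h x)
    rw [Nat.card_eq_fintype_card] at hF
    have := Finset.card_le_two (a := (0 : F)) (b := -1)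
    omega
  simp only [Finset.mem_insert, Finset.mem_singleton, not_or] at hc
  let i : Fin n := ⟨0, hn⟩
  obtain ⟨g, hg⟩ := exists_gl_one_add_vecMulVec (Pi.single i (1 : F)) (Pi.single i c) (by
    simpa using fun h => hc.2 (eq_neg_of_add_eq_zero_right h))
  have hg1 : g ≠ 1 := by
    rintro rfl
    have := congr_fun (congr_fun hg i) i
    simp [vecMulVec_apply, hc.1] at this
  refine ⟨g, hg1, finrank_fixedVec_one_add_vecMulVec hg hg1, ?_⟩
  rw [Set.ncard_eq_one]
  refine ⟨0, Set.eq_singleton_iff_unique_mem.2 ⟨zero_mem_pairingRadical _ _, fun v hv => ?_⟩⟩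
  ext k
  by_cases hk : k = i
  · have h := (mem_fixedVec g v.1).1 v.2
    rw [hg, add_mulVec, one_mulVec, vecMulVec_mulVec, add_eq_left] at h
    have h2 := congr_fun h i
    subst hk
    simpa [hc.1] using h2
  · exact apply_eq_zero_of_mem_pairingRadical hg hv hk

theorem exists_transvection [Finite F] (hF : Nat.card F = 2) (hn : 2 ≤ n) :
    ∃ g : GL (Fin n) F, g ≠ 1 ∧ Module.finrank F (fixedVec g) = n - 1 ∧
      (pairingRadical (fixedVec g) (fixedCovec g)).ncard = 2 := by
  let i : Fin n := ⟨0, by omega⟩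
  let j : Fin n := ⟨1, by omega⟩
  have hij : i ≠ j := by simp [i, j]
  obtain ⟨g, hg⟩ := exists_gl_one_add_vecMulVec (Pi.single i (1 : F)) (Pi.single j 1) (by
    simp [hij])
  have hg1 : g ≠ 1 := by
    rintro rfl
    have := congr_fun (congr_fun hg i) j
    simp [vecMulVec_apply, hij] at this
  have hd := finrank_fixedVec_one_add_vecMulVec hg hg1
  refine ⟨g, hg1, hd, le_antisymm ?_ (two_le_ncard_pairingRadical hF g (by omega))⟩
  rw [← hF, ← Nat.card_coe_set_eq]
  -- The radical lies on the i-th axis, so it has at most |F| = 2 elements.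
  refine Nat.card_le_card_of_injective (fun v => v.1.1 i) fun v w h => ?_
  ext k
  by_cases hk : k = i
  · subst hk; exact h
  · rw [apply_eq_zero_of_mem_pairingRadical hg v.2 hk,
      apply_eq_zero_of_mem_pairingRadical hg w.2 hk]

end Extremal

theorem mainTheorem6 {F : Type*} [Field F] [Finite F] (q : ℕ) (hq : Nat.card F = q)
    (n : ℕ) (hn : 2 ≤ n) :
    (2 < q →
      IsGreatest {x : ℝ | ∃ g : GL (Fin n) F, g ≠ 1 ∧
          x = classProportion (glCorner F n (one_le_two.trans hn)) g}
        ((1 - 1 / (q : ℝ) ^ (n - 1)) / ((q : ℝ) ^ 2 * (1 - 1 / (q : ℝ) ^ n)))) ∧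
    (q = 2 →
      IsGreatest {x : ℝ | ∃ g : GL (Fin n) F, g ≠ 1 ∧
          x = classProportion (glCorner F n (one_le_two.trans hn)) g}
        ((1 - 1 / (q : ℝ) ^ (n - 2)) / ((q : ℝ) ^ 2 * (1 - 1 / (q : ℝ) ^ n)))) := by
  have hq2 : 2 ≤ q := hq ▸ Finite.one_lt_card (α := F)
  have hq1 : (1 : ℝ) < q := by exact_mod_cast hq2
  have hq0 : (0 : ℝ) < q := by linarith
  have hD1 : (0 : ℝ) < (q : ℝ) ^ n - 1 := sub_pos.2 (one_lt_pow₀ hq1 (by omega))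
  have hD : (0 : ℝ) < (q : ℝ) ^ n * ((q : ℝ) ^ n - 1) := mul_pos (pow_pos hq0 n) hD1
  -- Rewrites the claimed values as d = n - 1 with r = q^(n-1-k): r = 1 for k = n - 1, r = q for k =
  -- n - 2.
  have hval (k : ℕ) (hk : k ≤ n - 1) :
      (1 - 1 / (q : ℝ) ^ k) / ((q : ℝ) ^ 2 * (1 - 1 / (q : ℝ) ^ n)) =
        (q : ℝ) ^ (n - 1) * ((q : ℝ) ^ (n - 1) - (q : ℝ) ^ (n - 1 - k)) /
          ((q : ℝ) ^ n * ((q : ℝ) ^ n - 1)) := by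
    obtain ⟨m, rfl⟩ : ∃ m, n = k + m + 1 := ⟨n - 1 - k, by omega⟩
    have h1 : k + m + 1 - 1 - k = m := by omega
    have h2 : (1 : ℝ) - 1 / (q : ℝ) ^ (k + m + 1) =
      ((q : ℝ) ^ (k + m + 1) - 1) / (q : ℝ) ^ (k + m + 1) := by field_simp
    rw [h1, h2, Nat.add_sub_cancel, div_eq_div_iff (by positivity) hD.ne']
    field_simp
    ring
  have hle (g : GL (Fin n) F) (hg : g ≠ 1) :
      (q : ℝ) ^ Module.finrank F (fixedVec g) ≤ (q : ℝ) ^ (n - 1) :=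
    pow_le_pow_right₀ hq1.le (Nat.le_sub_one_of_lt (finrank_fixedVec_lt g hg))
  have hR (g : GL (Fin n) F) :
      (1 : ℝ) ≤ ((pairingRadical (fixedVec g) (fixedCovec g)).ncard : ℝ) := by
    exact_mod_cast (Set.ncard_pos (Set.toFinite _)).2 ⟨0, zero_mem_pairingRadical _ _⟩
  have hone (d : ℕ) : (1 : ℝ) ≤ (q : ℝ) ^ d := one_le_pow₀ hq1.le
  constructor
  · intro hq3
    rw [hval (n - 1) le_rfl, Nat.sub_self, pow_zero]
    constructor
    · obtain ⟨g, hg, hd, hr⟩ := exists_reflection (F := F) (n := n) (hq ▸ hq3) (by omega)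
      refine ⟨g, hg, ?_⟩
      rw [classProportion_glCorner, hd, hr, hq, Nat.cast_one]
    · rintro _ ⟨g, hg, rfl⟩
      rw [classProportion_glCorner, hq]
      have h1 := hle g hg
      have h2 := hR g
      have h3 := hone (Module.finrank F (fixedVec g))
      refine div_le_div_of_nonneg_right ?_ hD.le
      exact (mul_le_mul_of_nonneg_left (sub_le_sub_left h2 _) (by linarith)).trans
        (mul_le_mul h1 (sub_le_sub_right h1 1) (by linarith) (by linarith))
  · rintro rfl
    rw [hval (n - 2) (by omega), show n - 1 - (n - 2) = 1 by omega, pow_one]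
    constructor
    · obtain ⟨g, hg, hd, hr⟩ := exists_transvection (F := F) (n := n) hq hn
      refine ⟨g, hg, ?_⟩
      rw [classProportion_glCorner, hd, hr, hq]
    · rintro _ ⟨g, hg, rfl⟩
      rw [classProportion_glCorner, hq]
      refine div_le_div_of_nonneg_right ?_ hD.le
      by_cases hd : Module.finrank F (fixedVec g) + 1 = n
      · have h2 : (2 : ℝ) ≤ ((pairingRadical (fixedVec g) (fixedCovec g)).ncard : ℝ) := by
          exact_mod_cast two_le_ncard_pairingRadical hq g hd
        rw [show Module.finrank F (fixedVec g) = n - 1 by omega]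
        gcongr
        exact_mod_cast h2
      -- Here d ≤ n - 2, so 2 · 2^d ≤ 2^(n-1), and r ≥ 1 suffices.
      · have h0 := finrank_fixedVec_lt g hg
        have h1 : ((2 : ℕ) : ℝ) ^ (Module.finrank F (fixedVec g) + 1) ≤
            ((2 : ℕ) : ℝ) ^ (n - 1) := pow_le_pow_right₀ hq1.le (by omega)
        have h2 := hR g
        have h3 := hone (Module.finrank F (fixedVec g))
        rw [pow_succ] at h1
        push_cast at h1 h3 ⊢
        nlinarith
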